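/- **Syntax and semantics.** Let $AP$ be a finite set of atomic propositions and fix an arbitrary total order on formulae. Formulae of linear temporal logic in positive normal form are given by $$\varphi,\psi ::= p \mid \neg p \mid \mathbf{tt} \mid \mathbf{ff} \mid \varphi\wedge\psi \mid \varphi\vee\psi \mid \mathbf{X}\varphi \mid \varphi\,\mathbf{U}\,\psi \mid \varphi\,\mathbf{R}\,\psi \qquad (p\in AP),$$ with the usual semantics over infinite words, where $\Diamond\psi=\mathbf{tt}\,\mathbf{U}\,\psi$ and $\Box\psi=\mathbf{ff}\,\mathbf{R}\,\psi$. A formula is satisfiable if it holds on some infinite word over some finite alphabet $\Sigma$ with an interpretation $\Sigma\to\mathcal P(AP)$. **Decomposition.** The decomposition rules are $\varphi\vee\psi\to\{\{\varphi\},\{\psi\}\}$; $\varphi\wedge\psi\to\{\{\varphi,\psi\}\}$; $\Diamond\varphi\to\{\{\varphi\},\{\mathbf X\Diamond\varphi\}\}$; $\Box\varphi\to\{\{\varphi,\mathbf X\Box\varphi\}\}$; $\varphi\,\mathbf U\,\psi\to\{\{\psi\},\{\varphi,\mathbf X(\varphi\,\mathbf U\,\psi)\}\}$; $\varphi\,\mathbf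 R\,\psi\to\{\{\psi,\varphi\vee\mathbf X(\varphi\,\mathbf R\,\psi)\}\}$; and $\mathbf{tt}\to\{\emptyset\}$ (the constant $\mathbf{tt}$ is dropped). A finite set $N$ of finite sets of formulae is rewritten by one of two kinds of steps: (i) for a rule $\varphi\to\{S_1,\dots,S_k\}$ and a member $S\cup\{\varphi\}$ of $N$ with $\varphi\notin S$, replace this member by $S\cup S_1,\dots,S\cup S_k$; (ii) (condition E1) if some members of $N$ contain $\mathbf{ff}$, or contain both $p$ and $\neg p$ for some $p$, remove all such members. Write $\psi\rightarrowtail^* N$ if $N$ is obtained from $\{\{\psi\}\}$ by such steps and no further step is possible on $N$. **Tableau.** Let $D$ assign to every formula $\psi$ a set $D(\psi)$ with $\psi\rightarrowtail^* D(\psi)$. The optimized tableau for $\varphi$ (with respect to $D$) is the directed graph of all nodes reachable from the initial pre-state $\{\varphi\}$, where the children of a pre-state $\{\psi\}$ are the states $S\in D(\psi)$, and the only child of a state $S$ is the pre-state $\{\bigwedge_{\mathbf X\psi\in S}\psi\}$; the conjunction is listed in the fixed order, and the empty conjunction is $\mathbf{tt}$. Pre-states and states are regarded as different nodes. A pre-state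 $\{\chi\}$ *contains* the conjuncts of $\chi$: the formula $\chi$ itself and, if $\chi=\alpha\wedge\beta$, the conjuncts of $\alpha$ and of $\beta$. A state $S$ *contains* $\psi$ if it includes an exhaustive decomposition of $\psi$, i.e. if $T\subseteq S$ for some $T\in N$ and some $N$ with $\psi\rightarrowtail^* N$. **Elimination.** Nodes are eliminated as long as one of the following conditions applies, i.e. the set of eliminated nodes is the least set of nodes of the tableau closed under them: - E2: all children of the node have been eliminated (in particular if it has none). - E3: the node is a pre-state that contains a formula $\alpha\,\mathbf U\,\psi$ (this includes $\Diamond\psi$) such that no path in the tableau of length $\ge 0$ leads from the node, through nodes that have not been eliminated, to a node that contains $\psi$. **Theorem (Correctness of the Optimized Tableau).** Some choice $D$ as above exists. For every such choice $D$ and every formula $\varphi$ in positive normal form, $\varphi$ is satisfiable if and only if the initial node $\{\varphi\}$ of the optimized tableau for $\varphi$ is not eliminated by conditions E2 and E3. -/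

import Mathlib

universe u

/-- Formulae of linear temporal logic over the atomic propositions `AP`. -/
inductive LTL (AP : Type u) : Type u
  | atom : AP → LTL AP
  | tt : LTL AP
  | neg : LTL AP → LTL AP
  | and : LTL AP → LTL AP → LTL AP
  | next : LTL AP → LTL AP
  | untl : LTL AP → LTL AP → LTL AP

namespace LTL

/-- `Holds I w φ`: the formula `φ` holds on the infinite word `w` over the alphabet `A`, where `I`
interprets each symbol as the set of atomic propositions that are true for it. -/
def Holds {AP A : Type u} (I : A → Set AP) : (ℕ → A) → LTL AP → Prop
  | w, atom p => p ∈ I (w 0)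
  | _, tt => True
  | w, neg φ => ¬ Holds I w φ
  | w, and φ ψ => Holds I w φ ∧ Holds I w ψ
  | w, next φ => Holds I (fun i => w (1 + i)) φ
  | w, untl φ ψ => ∃ n : ℕ, (∀ j < n, Holds I (fun i => w (j + i)) φ) ∧
      Holds I (fun i => w (n + i)) ψ

/-- Some infinite word over some finite interpreted alphabet is a model of `φ`. -/
def Satisfiable {AP : Type u} (φ : LTL AP) : Prop :=
  ∃ (A : Type u) (_ : Finite A) (I : A → Set AP) (w : ℕ → A), Holds I w φ

def ff {AP : Type u} : LTL AP := neg tt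
def or {AP : Type u} (φ ψ : LTL AP) : LTL AP := neg (and (neg φ) (neg ψ))
def release {AP : Type u} (φ ψ : LTL AP) : LTL AP := neg (untl (neg φ) (neg ψ))

end LTL

/-- LTL formulae in positive normal form. -/
inductive PNF (AP : Type u) : Type u
  | pos : AP → PNF AP
  | neg : AP → PNF AP
  | tt : PNF AP
  | ff : PNF AP
  | and : PNF AP → PNF AP → PNF AP
  | or : PNF AP → PNF AP → PNF AP
  | next : PNF AP → PNF AP
  | untl : PNF AP → PNF AP → PNF AP
  | release : PNF AP → PNF AP → PNF AP

namespace PNF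

/-- The LTL formula denoted by a formula in positive normal form. -/
def toLTL {AP : Type u} : PNF AP → LTL AP
  | pos p => LTL.atom p
  | neg p => LTL.neg (LTL.atom p)
  | tt => LTL.tt
  | ff => LTL.ff
  | and φ ψ => LTL.and φ.toLTL ψ.toLTL
  | or φ ψ => LTL.or φ.toLTL ψ.toLTL
  | next φ => LTL.next φ.toLTL
  | untl φ ψ => LTL.untl φ.toLTL ψ.toLTL
  | release φ ψ => LTL.release φ.toLTL ψ.toLTL

def Satisfiable {AP : Type u} (φ : PNF AP) : Prop := φ.toLTL.Satisfiable

/-- `◇ψ = tt U ψ`. -/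
def eventually {AP : Type u} (ψ : PNF AP) : PNF AP := untl tt ψ

/-- `□ψ = ff R ψ`. -/
def always {AP : Type u} (ψ : PNF AP) : PNF AP := release ff ψ

/-- The formula `ψ` is a conjunct of the given formula: the formula itself or, if that is a
conjunction, a conjunct of one of its two sides. -/
inductive IsConjunct {AP : Type u} (ψ : PNF AP) : PNF AP → Prop
  | self : IsConjunct ψ ψ
  | left {α β : PNF AP} : IsConjunct ψ α → IsConjunct ψ (and α β)
  | right {α β : PNF AP} : IsConjunct ψ β → IsConjunct ψ (and α β)

/-- The conjunction of a list of formulae; the empty conjunction is `tt`. -/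
def conjList {AP : Type u} : List (PNF AP) → PNF AP
  | [] => tt
  | [φ] => φ
  | φ :: ψ :: l => and φ (conjList (ψ :: l))

end PNF

namespace Tableau

open PNF

/- The linear order on formulae is an arbitrary one. It is used only to fix in which order the
members of a finite set of formulae are listed in their conjunction. -/
variable {AP : Type u} [LinearOrder (PNF AP)]

/-- The decomposition rules `φ → {S₁, …, Sₖ}`: rules D1 to D6, and the rule by which the constant
`tt` is dropped. -/
inductive Decomp : PNF AP → Finset (Finset (PNF AP)) → Prop
  | d1 (φ ψ : PNF AP) : Decomp (or φ ψ) {{φ}, {ψ}}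
  | d2 (φ ψ : PNF AP) : Decomp (and φ ψ) {{φ, ψ}}
  | d3 (φ : PNF AP) : Decomp (eventually φ) {{φ}, {next (eventually φ)}}
  | d4 (φ : PNF AP) : Decomp (always φ) {{φ, next (always φ)}}
  | d5 (φ ψ : PNF AP) : Decomp (untl φ ψ) {{ψ}, {φ, next (untl φ ψ)}}
  | d6 (φ ψ : PNF AP) : Decomp (release φ ψ) {{ψ, or φ (next (release φ ψ))}}
  | top : Decomp tt {∅}

/-- The condition E1: the set contains a proposition together with its negation, or the constant
`ff` (which is the negation of `tt`). -/
def Clash (S : Finset (PNF AP)) : Prop :=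
  ff ∈ S ∨ ∃ p : AP, pos p ∈ S ∧ neg p ∈ S

open Classical in
/-- One rewrite step between finite sets of sets of formulae: either one formula `φ` of one set
`S ∪ {φ}` is replaced according to a decomposition rule, or E1 is applied globally (and removes
something). -/
inductive Rewrite : Finset (Finset (PNF AP)) → Finset (Finset (PNF AP)) → Prop
  | decomp {φ : PNF AP} {R : Finset (Finset (PNF AP))} (S : Finset (PNF AP))
      (N : Finset (Finset (PNF AP))) (hR : Decomp φ R) (hS : φ ∉ S) (hN : insert φ S ∉ N) :
      Rewrite (insert (insert φ S) N) (R.image (fun T => S ∪ T) ∪ N)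
  | elim (N : Finset (Finset (PNF AP))) (hN : ∃ S ∈ N, Clash S) :
      Rewrite N (N.filter (fun S => ¬ Clash S))

/-- `φ ↣* N`: the set `N` results from `{{φ}}` by rewriting until no step is possible. -/
def FullyRewrites (φ : PNF AP) (N : Finset (Finset (PNF AP))) : Prop :=
  Relation.ReflTransGen Rewrite {{φ}} N ∧ ∀ N', ¬ Rewrite N N'

/-- The set `{ψ | Xψ ∈ S}`. -/
def nexts (S : Finset (PNF AP)) : Finset (PNF AP) :=
  S.biUnion fun φ => match φ with
    | next ψ => {ψ}
    | _ => ∅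

/-- The pre-state formula of the step rule: the conjunction of all `ψ` with `Xψ ∈ S`. -/
def stepFormula (S : Finset (PNF AP)) : PNF AP :=
  conjList ((nexts S).sort (· ≤ ·))

/-- A choice, for every formula `ψ`, of a result of exhaustively rewriting `{{ψ}}`. -/
def IsDecomposition (D : PNF AP → Finset (Finset (PNF AP))) : Prop :=
  ∀ ψ : PNF AP, FullyRewrites ψ (D ψ)

/-- Nodes of the optimized tableau: the pre-state `{ψ}`, and state nodes. -/
inductive Node (AP : Type u) : Type u
  | pre : PNF AP → Node AP
  | state : Finset (PNF AP) → Node AP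

/-- The children of a node: those of the pre-state `{ψ}` are the members of `D ψ`, and the only
child of a state is given by the step rule. -/
inductive Child (D : PNF AP → Finset (Finset (PNF AP))) : Node AP → Node AP → Prop
  | decomposition {ψ : PNF AP} {S : Finset (PNF AP)} (h : S ∈ D ψ) :
      Child D (Node.pre ψ) (Node.state S)
  | step (S : Finset (PNF AP)) : Child D (Node.state S) (Node.pre (stepFormula S))

/-- The nodes that the construction for `φ` generates. -/
def Generated (D : PNF AP → Finset (Finset (PNF AP))) (φ : PNF AP) : Set (Node AP) :=
  {v | Relation.ReflTransGen (Child D) (Node.pre φ) v}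

/-- The node contains the formula `ψ`. A pre-state contains the conjuncts of its formula. A state,
from which decomposed formulae have been dropped, contains the formulae of which it includes an
exhaustive decomposition; in particular it contains all its members. -/
def Contains : Node AP → PNF AP → Prop
  | Node.pre χ, ψ => IsConjunct ψ χ
  | Node.state S, ψ => ∃ N, FullyRewrites ψ N ∧ ∃ T ∈ N, T ⊆ S

/-- Condition E2, where `E` is the set of nodes eliminated so far: all successors of `v` have been
eliminated. -/
def E2 (D : PNF AP → Finset (Finset (PNF AP))) (E : Set (Node AP)) (v : Node AP) : Prop :=
  ∀ w, Child D v w → w ∈ E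

/-- There is a path from `v`, through nodes that have not been eliminated, to a node that contains
the formula `ψ`. -/
def Fulfillable (D : PNF AP → Finset (Finset (PNF AP))) (E : Set (Node AP)) (v : Node AP)
    (ψ : PNF AP) : Prop :=
  ∃ w, Relation.ReflTransGen (fun x y => Child D x y ∧ y ∉ E) v w ∧ Contains w ψ

/-- Condition E3, where `E` is the set of nodes eliminated so far: `v` is a pre-state that contains
a formula `α U ψ` (this includes `◇ψ = tt U ψ`) which is not satisfiable in it. -/
def E3 (D : PNF AP → Finset (Finset (PNF AP))) (E : Set (Node AP)) (v : Node AP) : Prop :=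
  (∃ χ, v = Node.pre χ) ∧ ∃ α ψ : PNF AP, Contains v (untl α ψ) ∧ ¬ Fulfillable D E v ψ

/-- The set of eliminated nodes in the tableau for `φ`: the least set of nodes that is closed under
the conditions E2 and E3. -/
def Eliminated (D : PNF AP → Finset (Finset (PNF AP))) (φ : PNF AP) : Set (Node AP) :=
  ⋂₀ {E | ∀ v ∈ Generated D φ, E2 D E v ∨ E3 D E v → v ∈ E}

end Tableau

/-! Satisfiable implies not eliminated: fix the interpreted alphabet of a model. The nodes true on
no word over it form a set closed under E2 and E3, so it includes the least such set. For E2, a true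
formula has a true branch at every decomposition, E1 never removes a true set, and the step rule
passes to the suffix. For E3, a path must actually reach `ψ`: a true branch can be chosen that
postpones `α U ψ` only while `ψ` is false (`exists_state_models_untl`), so fulfilment comes no later
than in the model (`fulfillable_of_models`).

Conversely, every surviving state has a surviving successor, and every until-formula that it
contains can be fulfilled along surviving states. Fair scheduling (`exists_fair_run`) merges these
finite paths into one run that fulfils all until-formulae. The positive literals of the run define a
word, and induction on formulae shows that all contained formulae hold on it (`models_of_fair_run`).

Since `D` is arbitrary and states forget decomposed formulae, both directions need to know what a
state contains. `Tracks` follows the rewriting of one formula inside the rewriting of another. -/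

namespace PNF

variable {AP : Type u}

/-- Satisfaction of a formula in positive normal form on an infinite word. -/
def Models {A : Type u} (I : A → Set AP) (w : ℕ → A) (φ : PNF AP) : Prop :=
  LTL.Holds I w φ.toLTL

/-- The suffix of an infinite word that starts at a given position. -/
def suffix {A : Type u} (w : ℕ → A) (n : ℕ) : ℕ → A := fun i => w (n + i)

/-! ### Semantics of positive normal form: fixpoint laws and conjunctions -/

section Semantics

variable {A : Type u} {I : A → Set AP} {w : ℕ → A} {φ ψ : PNF AP}

theorem suffix_def (n : ℕ) : suffix w n = fun i => w (n + i) := rfl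

@[simp] theorem suffix_zero : suffix w 0 = w := by
  funext i; simp [suffix]

@[simp] theorem suffix_suffix (m n : ℕ) : suffix (suffix w m) n = suffix w (m + n) := by
  funext i; simp [suffix, Nat.add_assoc]

@[simp] theorem models_pos {p : AP} : Models I w (pos p) ↔ p ∈ I (w 0) := by
  simp [Models, toLTL, LTL.Holds]

@[simp] theorem models_neg {p : AP} : Models I w (neg p) ↔ p ∉ I (w 0) := by
  simp [Models, toLTL, LTL.Holds]

@[simp] theorem models_tt : Models I w tt := by
  simp [Models, toLTL, LTL.Holds]

@[simp] theorem not_models_ff : ¬ Models I w ff := by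
  simp [Models, toLTL, LTL.ff, LTL.Holds]

@[simp] theorem models_and : Models I w (and φ ψ) ↔ Models I w φ ∧ Models I w ψ := by
  simp [Models, toLTL, LTL.Holds]

@[simp] theorem models_or : Models I w (or φ ψ) ↔ Models I w φ ∨ Models I w ψ := by
  simp only [Models, toLTL, LTL.or, LTL.Holds]; tauto

@[simp] theorem models_next : Models I w (next φ) ↔ Models I (suffix w 1) φ := by
  simp [Models, toLTL, LTL.Holds, suffix_def]

theorem models_untl : Models I w (untl φ ψ) ↔
    ∃ n, (∀ j < n, Models I (suffix w j) φ) ∧ Models I (suffix w n) ψ := by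
  simp [Models, toLTL, LTL.Holds, suffix_def]

theorem models_release : Models I w (release φ ψ) ↔
    ∀ n, (∀ j < n, ¬ Models I (suffix w j) φ) → Models I (suffix w n) ψ := by
  simp [Models, toLTL, LTL.release, LTL.Holds, suffix_def]

theorem models_untl_iff : Models I w (untl φ ψ) ↔
    Models I w ψ ∨ Models I w φ ∧ Models I (suffix w 1) (untl φ ψ) := by
  simp only [models_untl, suffix_suffix]
  constructor
  · rintro ⟨_ | n, h, hn⟩
    · left; simpa using hn
    · refine Or.inr ⟨by simpa using h 0 (by omega), n, fun j hj => ?_, ?_⟩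
      · rw [Nat.add_comm]; exact h _ (by omega)
      · rwa [Nat.add_comm]
  · rintro (h | ⟨h0, n, h, hn⟩)
    · exact ⟨0, by simp, by simpa using h⟩
    · refine ⟨n + 1, fun j hj => ?_, by rwa [Nat.add_comm]⟩
      rcases j with _ | j
      · simpa using h0
      · rw [Nat.add_comm]; exact h _ (by omega)

theorem models_release_iff : Models I w (release φ ψ) ↔
    Models I w ψ ∧ (Models I w φ ∨ Models I (suffix w 1) (release φ ψ)) := by
  simp only [models_release, suffix_suffix]
  constructor
  · intro h
    refine ⟨by simpa using h 0, or_iff_not_imp_left.2 fun h0 n hn => ?_⟩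
    rw [Nat.add_comm]
    refine h _ fun j hj => ?_
    rcases j with _ | j
    · simpa using h0
    · rw [Nat.add_comm]; exact hn _ (by omega)
  · rintro ⟨h0, h⟩ n hn
    rcases n with _ | n
    · simpa using h0
    · rcases h with h | h
      · exact absurd h (by simpa using hn 0 (by omega))
      · rw [Nat.add_comm]
        exact h _ fun j hj => by rw [Nat.add_comm]; exact hn _ (by omega)

theorem IsConjunct.models (h : IsConjunct ψ φ) (hφ : Models I w φ) : Models I w ψ := by
  induction h with
  | self => exact hφ
  | left _ ih => exact ih (models_and.1 hφ).1
  | right _ ih => exact ih (models_and.1 hφ).2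

theorem models_conjList {l : List (PNF AP)} (h : ∀ φ ∈ l, Models I w φ) :
    Models I w (conjList l) := by
  induction l with
  | nil => exact models_tt
  | cons φ l ih =>
    rcases l with _ | ⟨ψ, l⟩
    · exact h φ (by simp)
    · exact models_and.2 ⟨h φ (by simp), ih fun χ hχ => h χ (List.mem_cons_of_mem _ hχ)⟩

theorem isConjunct_conjList {l : List (PNF AP)} (h : φ ∈ l) : IsConjunct φ (conjList l) := by
  induction l with
  | nil => simp at h
  | cons χ l ih =>
    rcases l with _ | ⟨ψ, l⟩
    · rw [List.mem_singleton.1 h]; exact .self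
    · rcases List.mem_cons.1 h with rfl | h
      · exact .left .self
      · exact .right (ih h)

end Semantics

/-- A Gödel numbering of formulae, given a numbering of the atomic propositions. -/
def code (e : AP → ℕ) : PNF AP → ℕ
  | pos p => Nat.pair 0 (e p)
  | neg p => Nat.pair 1 (e p)
  | tt => Nat.pair 2 0
  | ff => Nat.pair 3 0
  | and φ ψ => Nat.pair 4 (Nat.pair (code e φ) (code e ψ))
  | or φ ψ => Nat.pair 5 (Nat.pair (code e φ) (code e ψ))
  | next φ => Nat.pair 6 (code e φ)
  | untl φ ψ => Nat.pair 7 (Nat.pair (code e φ) (code e ψ))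
  | release φ ψ => Nat.pair 8 (Nat.pair (code e φ) (code e ψ))

/-- This makes the set of formulae countable, so that fair scheduling can enumerate all
until-formulae as goals. -/
theorem code_injective {e : AP → ℕ} (he : Function.Injective e) :
    Function.Injective (code e) := by
  intro φ
  induction φ with
  | pos | neg => intro ψ; cases ψ <;> simp [code, Nat.pair_eq_pair, he.eq_iff]
  | tt | ff => intro ψ; cases ψ <;> simp [code, Nat.pair_eq_pair]
  | next φ ih =>
    intro ψ; cases ψ <;> simp [code, Nat.pair_eq_pair]
    exact fun h => ih h
  | and φ ψ ih₁ ih₂ | or φ ψ ih₁ ih₂ | untl φ ψ ih₁ ih₂ | release φ ψ ih₁ ih₂ =>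
    intro χ; cases χ <;> simp [code, Nat.pair_eq_pair]
    exact fun h₁ h₂ => ⟨ih₁ h₁, ih₂ h₂⟩

instance [Countable AP] : Countable (PNF AP) :=
  let ⟨_, he⟩ := exists_injective_nat AP
  (code_injective he).countable

/-- An upper bound for the number of decomposition steps that a formula allows. -/
def weight : PNF AP → ℕ
  | tt => 1
  | and φ ψ => φ.weight + ψ.weight + 1
  | or φ ψ => φ.weight + ψ.weight + 1
  | untl φ ψ => φ.weight + ψ.weight + 1
  | release φ ψ => φ.weight + ψ.weight + 2
  | _ => 0

end PNF

/-! ### Fair runs in transition systems -/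

/-- Fair scheduling: if in a transition system without dead ends every pending goal can be
achieved and stays pending until it is achieved, then there is an infinite run on which every
pending goal is eventually achieved. -/
theorem exists_fair_run {V K : Type*} [Countable K] {R : V → V → Prop} {P Q : K → V → Prop}
    (succ : ∀ v, ∃ v', R v v') (persist : ∀ k v v', P k v → ¬ Q k v → R v v' → P k v')
    (live : ∀ k v, P k v → ∃ v', Relation.ReflTransGen R v v' ∧ Q k v') (v₀ : V) :
    ∃ f : ℕ → V, f 0 = v₀ ∧ (∀ i, R (f i) (f (i + 1))) ∧
      ∀ k i, P k (f i) → ∃ j ≥ i, Q k (f j) := by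
  classical
  rcases isEmpty_or_nonempty K with hK | hK
  · choose s hs using succ
    exact ⟨fun i => s^[i] v₀, rfl, fun i => by simpa [Function.iterate_succ_apply'] using hs _,
      fun k => (hK.false k).elim⟩
  obtain ⟨e, he⟩ := exists_surjective_nat K
  -- Unpairing makes every goal recur at arbitrarily large indices.
  let goal : ℕ → K := fun n => e n.unpair.1
  have hgoal : ∀ k n, ∃ m ≥ n, goal m = k := fun k n => by
    obtain ⟨a, rfl⟩ := he k
    exact ⟨Nat.pair a n, Nat.right_le_pair a n, by simp [goal]⟩
  let Reach : K → ℕ → V → Prop := fun k d v => ∃ g : ℕ → V, g 0 = v ∧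
    (∀ i < d, R (g i) (g (i + 1))) ∧ Q k (g d)
  have hreach : ∀ k v, P k v → ∃ d, Reach k d v := fun k v hv => by
    obtain ⟨v', hp, hq⟩ := live k v hv
    clear hv
    induction hp using Relation.ReflTransGen.head_induction_on with
    | refl => exact ⟨0, fun _ => v', rfl, by simp, hq⟩
    | head h _ ih =>
      obtain ⟨d, g, hg0, hg, hgd⟩ := ih
      refine ⟨d + 1, fun i => Nat.casesOn i (motive := fun _ => V) _ g, rfl, fun i hi => ?_, hgd⟩
      rcases i with _ | i
      · simpa [hg0] using h
      · exact hg i (by omega)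
  have hstep : ∀ k d v, Reach k (d + 1) v → ∃ v', R v v' ∧ Reach k d v' := by
    rintro k d v ⟨g, rfl, hg, hq⟩
    exact ⟨g 1, hg 0 (by omega), fun i => g (i + 1), rfl, fun i hi => hg _ (by omega), hq⟩
  -- The scheduler's state pairs a vertex with the index of the current goal. If that goal is
  -- achieved or not pending, the index advances; otherwise the move follows a shortest path to the
  -- goal, so the distance drops.
  have hmove : ∀ s : V × ℕ, ∃ s' : V × ℕ, R s.1 s'.1 ∧
      ((¬ P (goal s.2) s.1 ∨ Q (goal s.2) s.1) ∧ s'.2 = s.2 + 1 ∨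
        (P (goal s.2) s.1 ∧ ¬ Q (goal s.2) s.1) ∧ s'.2 = s.2 ∧
          ∀ d, (∀ d' < d, ¬ Reach (goal s.2) d' s.1) → Reach (goal s.2) d s.1 →
            ∃ d' < d, Reach (goal s.2) d' s'.1) := by
    rintro ⟨v, n⟩
    by_cases h : P (goal n) v ∧ ¬ Q (goal n) v
    · have hex := hreach _ _ h.1
      rcases hd : Nat.find hex with _ | d
      · obtain ⟨g, rfl, -, hq⟩ := hd ▸ Nat.find_spec hex
        exact absurd hq h.2
      · obtain ⟨v', hv', hr⟩ := hstep _ _ _ (hd ▸ Nat.find_spec hex)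
        refine ⟨(v', n), hv', Or.inr ⟨h, rfl, fun d₁ h₁ h₂ => ⟨d, ?_, hr⟩⟩⟩
        have : Nat.find hex = d₁ := (Nat.find_eq_iff hex).2 ⟨h₂, h₁⟩
        omega
    · obtain ⟨v', hv'⟩ := succ v
      exact ⟨(v', n + 1), hv', Or.inl ⟨by tauto, rfl⟩⟩
  choose move hR hmv using hmove
  let s : ℕ → V × ℕ := fun i => move^[i] (v₀, 0)
  have hs : ∀ i, s (i + 1) = move (s i) := fun i => Function.iterate_succ_apply' ..
  have hserve : ∀ d i, Reach (goal (s i).2) d (s i).1 → ∃ j ≥ i, (s j).2 = (s i).2 ∧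
      (¬ P (goal (s i).2) (s j).1 ∨ Q (goal (s i).2) (s j).1) := by
    intro d
    induction d using Nat.strong_induction_on with
    | _ d ih =>
      intro i hi
      by_cases hlt : ∃ d' < d, Reach (goal (s i).2) d' (s i).1
      · obtain ⟨d', hd', hr⟩ := hlt
        exact ih d' hd' i hr
      push Not at hlt
      rcases hmv (s i) with h | ⟨-, h2, h3⟩
      · exact ⟨i, le_rfl, rfl, h.1⟩
      · obtain ⟨d', hd', hr⟩ := h3 d hlt hi
        rw [← hs] at h2 hr
        obtain ⟨j, hj, hj2, hj3⟩ := ih d' hd' (i + 1) (by rwa [h2])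
        exact ⟨j, by omega, by rw [hj2, h2], by rwa [h2] at hj3⟩
  have hserve' : ∀ i, ∃ j ≥ i, (s j).2 = (s i).2 ∧
      (¬ P (goal (s i).2) (s j).1 ∨ Q (goal (s i).2) (s j).1) := by
    intro i
    by_cases h : P (goal (s i).2) (s i).1
    · obtain ⟨d, hd⟩ := hreach _ _ h
      exact hserve d i hd
    · exact ⟨i, le_rfl, rfl, Or.inl h⟩
  have hadv : ∀ i, ∃ j ≥ i, (s j).2 = (s i).2 + 1 := by
    intro i
    obtain ⟨j, hj, hj2, hj3⟩ := hserve' i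
    refine ⟨j + 1, by omega, ?_⟩
    rcases hmv (s j) with h | h
    · rw [hs, h.2, hj2]
    · rw [hj2] at h; tauto
  have hall : ∀ i n, (s i).2 ≤ n → ∃ j ≥ i, (s j).2 = n := by
    intro i n hn
    induction n, hn using Nat.le_induction with
    | base => exact ⟨i, le_rfl, rfl⟩
    | succ n _ ih =>
      obtain ⟨j, hj, rfl⟩ := ih
      obtain ⟨j', hj', h⟩ := hadv j
      exact ⟨j', by omega, h⟩
  refine ⟨fun i => (s i).1, rfl, fun i => by simpa only [hs] using hR (s i), fun k i hk => ?_⟩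
  obtain ⟨n, hn, rfl⟩ := hgoal k (s i).2
  obtain ⟨j, hj, rfl⟩ := hall i n hn
  obtain ⟨l, hl, -, h⟩ := hserve' j
  by_contra hno
  push Not at hno
  -- A goal never achieved from `i` on would stay pending forever, but the scheduler leaves it at
  -- `l` achieved or not pending.
  have hpend : ∀ m ≥ i, P (goal (s j).2) (s m).1 := fun m hm => by
    induction m, hm using Nat.le_induction with
    | base => exact hk
    | succ m hm ih => exact persist _ _ _ ih (hno m hm) (by rw [hs]; exact hR _)
  exact h.elim (fun h => h (hpend l (by omega))) (hno l (by omega))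

namespace Tableau

open PNF Relation

variable {AP : Type u} [LinearOrder (PNF AP)]

/-! ### Termination of rewriting, and what irreducible states contain -/

section Rewriting

variable {φ ψ : PNF AP} {S T : Finset (PNF AP)} {N N' R : Finset (Finset (PNF AP))}

/-- No decomposition rule applies to the set, and it is not removed by E1. -/
def Irreducible (S : Finset (PNF AP)) : Prop :=
  ¬ Clash S ∧ ∀ φ ∈ S, ∀ R, ¬ Decomp φ R

theorem Clash.mono (h : Clash S) (hST : S ⊆ T) : Clash T :=
  h.imp (fun h => hST h) fun ⟨p, hp, hn⟩ => ⟨p, hST hp, hST hn⟩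

theorem Irreducible.mono (h : Irreducible T) (hST : S ⊆ T) : Irreducible S :=
  ⟨fun hc => h.1 (hc.mono hST), fun φ hφ => h.2 φ (hST hφ)⟩

theorem rewrite_of_mem (hS : S ∈ N) (hφ : φ ∈ S) (hR : Decomp φ R) :
    Rewrite N (R.image (fun T => S.erase φ ∪ T) ∪ N.erase S) := by
  have := Rewrite.decomp (S.erase φ) (N.erase S) hR (Finset.notMem_erase φ S)
    (by rw [Finset.insert_erase hφ]; exact Finset.notMem_erase S N)
  rwa [Finset.insert_erase hφ, Finset.insert_erase hS] at this

theorem normal_iff : (∀ N', ¬ Rewrite N N') ↔ ∀ S ∈ N, Irreducible S := by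
  constructor
  · exact fun h S hS => ⟨fun hc => h _ (.elim N ⟨S, hS, hc⟩),
      fun φ hφ R hR => h _ (rewrite_of_mem hS hφ hR)⟩
  · rintro h N' (⟨S, N, hR, -, -⟩ | ⟨_, S, hS, hc⟩)
    · exact (h _ (Finset.mem_insert_self _ _)).2 _ (Finset.mem_insert_self _ _) _ hR
    · exact (h S hS).1 hc

/-- The sum of the weights of the members of a set of formulae. -/
def setWeight (S : Finset (PNF AP)) : ℕ := ∑ φ ∈ S, φ.weight

theorem setWeight_union_le : setWeight (S ∪ T) ≤ setWeight S + setWeight T := by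
  have := Finset.sum_union_inter (s₁ := S) (s₂ := T) (f := weight)
  unfold setWeight; omega

theorem setWeight_insert_le : setWeight (insert φ S) ≤ φ.weight + setWeight S := by
  rw [Finset.insert_eq]
  exact setWeight_union_le.trans (by simp [setWeight])

@[simp] theorem setWeight_singleton : setWeight ({φ} : Finset (PNF AP)) = φ.weight := by
  simp [setWeight]

/-- Next-formulae weigh nothing because no rule decomposes them. The summand 2 in the weight of a
release pays for its own step and for the disjunction that this step creates. -/
theorem Decomp.setWeight_lt (h : Decomp φ R) (hT : T ∈ R) : setWeight T < φ.weight := by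
  have pair : ∀ α β : PNF AP, setWeight {α, β} ≤ α.weight + β.weight := fun α β =>
    setWeight_insert_le.trans (by simp)
  cases h <;> simp only [Finset.mem_insert, Finset.mem_singleton] at hT
  case d1 α β => rcases hT with rfl | rfl <;> simp [weight]
  case d2 α β => subst hT; have := pair α β; simp [weight]; omega
  case d3 α => rcases hT with rfl | rfl <;> simp [weight, eventually]
  case d4 α => subst hT; have := pair α (next (always α)); simp [weight, always] at *; omega
  case d5 α β =>
    have := pair α (next (untl α β))
    rcases hT with rfl | rfl
    · simp [weight]
    · simp [weight] at *; omega
  case d6 α β =>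
    subst hT
    have := pair β (or α (next (release α β)))
    simp [weight] at *; omega
  case top => subst hT; simp [weight, setWeight]

theorem Decomp.card_le (h : Decomp φ R) : R.card ≤ 2 := by
  cases h
  case d1 | d3 | d5 => exact Finset.card_le_two
  all_goals simp

/-- A measure on sets of sets of formulae that every rewrite step decreases. -/
def totalWeight (N : Finset (Finset (PNF AP))) : ℕ := ∑ S ∈ N, 3 ^ setWeight S

/-- A decomposition yields at most two branches, each lighter by at least one. With base 3 their sum
is at most two thirds of the term replaced; merging of equal sets only helps. -/
theorem Rewrite.totalWeight_lt (h : Rewrite N N') : totalWeight N' < totalWeight N := by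
  rcases h with ⟨S, N, hR, hS, hN⟩ | ⟨_, S, hS, hc⟩
  · rename_i φ R
    have hw : setWeight (insert φ S) = φ.weight + setWeight S := Finset.sum_insert hS
    have hbranch : ∀ T ∈ R, 3 * 3 ^ setWeight (S ∪ T) ≤ 3 ^ setWeight (insert φ S) := by
      intro T hT
      rw [← pow_succ']
      refine Nat.pow_le_pow_right (by norm_num) ?_
      have := hR.setWeight_lt hT
      have := setWeight_union_le (S := S) (T := T)
      omega
    have himage : totalWeight (R.image fun T => S ∪ T) ≤ ∑ T ∈ R, 3 ^ setWeight (S ∪ T) :=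
      Finset.sum_image_le_of_nonneg (fun _ _ => Nat.zero_le _)
    have hsum : 3 * ∑ T ∈ R, 3 ^ setWeight (S ∪ T) ≤ 2 * 3 ^ setWeight (insert φ S) := by
      rw [Finset.mul_sum]
      refine (Finset.sum_le_card_nsmul _ _ _ hbranch).trans ?_
      exact Nat.mul_le_mul_right _ hR.card_le
    have hpos : 0 < 3 ^ setWeight (insert φ S) := by positivity
    have hunion : totalWeight ((R.image fun T => S ∪ T) ∪ N) ≤
        totalWeight (R.image fun T => S ∪ T) + totalWeight N := by
      have := Finset.sum_union_inter (s₁ := R.image fun T => S ∪ T) (s₂ := N)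
        (f := fun S => 3 ^ setWeight S)
      unfold totalWeight; omega
    have hins : totalWeight (insert (insert φ S) N) =
        3 ^ setWeight (insert φ S) + totalWeight N := Finset.sum_insert hN
    omega
  · classical
    refine Finset.sum_lt_sum_of_subset (Finset.filter_subset _ _) hS (by simp [hc])
      (by positivity) (fun _ _ _ => Nat.zero_le _)

theorem exists_normal (N : Finset (Finset (PNF AP))) :
    ∃ N', ReflTransGen Rewrite N N' ∧ ∀ N'', ¬ Rewrite N' N'' := by
  induction hn : totalWeight N using Nat.strong_induction_on generalizing N with
  | _ n ih =>
    by_cases h : ∃ N', Rewrite N N'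
    · obtain ⟨N', hN'⟩ := h
      obtain ⟨N'', h₁, h₂⟩ := ih _ (hn ▸ hN'.totalWeight_lt) N' rfl
      exact ⟨N'', .head hN' h₁, h₂⟩
    · push Not at h
      exact ⟨N, .refl, h⟩

theorem exists_isDecomposition :
    ∃ D : PNF AP → Finset (Finset (PNF AP)), IsDecomposition D :=
  Classical.axiomOfChoice fun ψ => exists_normal {{ψ}}

/-- A property of sets of formulae that every branch of a decomposition preserves holds for all
members of the rewritten set. -/
theorem forall_mem_of_rewrites {p : Finset (PNF AP) → Prop}
    (step : ∀ S φ R, φ ∉ S → p (insert φ S) → Decomp φ R → ∀ T ∈ R, p (S ∪ T))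
    (h : ReflTransGen Rewrite N N') (hN : ∀ S ∈ N, p S) : ∀ S ∈ N', p S := by
  induction h with
  | refl => exact hN
  | tail _ h ih =>
    rcases h with ⟨S, N, hR, hS, -⟩ | ⟨_, -⟩
    · intro S' hS'
      rcases Finset.mem_union.1 hS' with h | h
      · obtain ⟨T, hT, rfl⟩ := Finset.mem_image.1 h
        exact step S _ _ hS (ih _ (Finset.mem_insert_self _ _)) hR T hT
      · exact ih _ (Finset.mem_insert_of_mem h)
    · intro S hS
      classical exact ih S (Finset.mem_filter.1 hS).1

/-- A property of clash-free sets of formulae that some branch of each decomposition preserves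
holds for a member of the rewritten set. -/
theorem exists_mem_of_rewrites {p : Finset (PNF AP) → Prop}
    (step : ∀ S φ R, φ ∉ S → p (insert φ S) → Decomp φ R → ∃ T ∈ R, p (S ∪ T))
    (clash : ∀ S, p S → ¬ Clash S) (h : ReflTransGen Rewrite N N') (hN : ∃ S ∈ N, p S) :
    ∃ S ∈ N', p S := by
  induction h with
  | refl => exact hN
  | tail _ h ih =>
    obtain ⟨S', hS', hp⟩ := ih
    rcases h with ⟨S, N, hR, hS, -⟩ | ⟨_, -⟩
    · rcases Finset.mem_insert.1 hS' with rfl | h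
      · obtain ⟨T, hT, hpT⟩ := step S _ _ hS hp hR
        exact ⟨_, Finset.mem_union_left _ (Finset.mem_image_of_mem _ hT), hpT⟩
      · exact ⟨S', Finset.mem_union_right _ h, hp⟩
    · classical exact ⟨S', Finset.mem_filter.2 ⟨hS', clash _ hp⟩, hp⟩

/-- The set includes a member of a, not necessarily exhaustive, decomposition of the formula. -/
def Tracks (ψ : PNF AP) (S : Finset (PNF AP)) : Prop :=
  ∃ N, ReflTransGen Rewrite {{ψ}} N ∧ ∃ T ∈ N, T ⊆ S

theorem tracks_of_mem (h : ψ ∈ S) : Tracks ψ S :=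
  ⟨_, .refl, _, Finset.mem_singleton_self _, Finset.singleton_subset_iff.2 h⟩

/-- If the tracked set uses `φ`, the same rule is replayed in the derivation from `ψ`; otherwise the
set survives the removal of `φ`. -/
theorem Tracks.union (h : Tracks ψ (insert φ S)) (hR : Decomp φ R) (hT : T ∈ R) :
    Tracks ψ (S ∪ T) := by
  obtain ⟨N, hN, U, hU, hUS⟩ := h
  by_cases hφ : φ ∈ U
  · refine ⟨_, hN.tail (rewrite_of_mem hU hφ hR), U.erase φ ∪ T,
      Finset.mem_union_left _ (Finset.mem_image_of_mem _ hT),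
      Finset.union_subset_union_left fun χ hχ => ?_⟩
    obtain ⟨hne, hχ⟩ := Finset.mem_erase.1 hχ
    exact (Finset.mem_insert.1 (hUS hχ)).resolve_left hne
  · refine ⟨N, hN, U, hU, fun χ hχ => Finset.mem_union_left _ ?_⟩
    exact (Finset.mem_insert.1 (hUS hχ)).resolve_left fun h => hφ (h ▸ hχ)

/-- A subset of an irreducible set is irreducible, so it survives unchanged while the rest of the
derivation is rewritten to normal form. -/
theorem Tracks.contains (h : Tracks ψ S) (hS : Irreducible S) : Contains (.state S) ψ := by
  obtain ⟨N, hN, U, hU, hUS⟩ := h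
  obtain ⟨N', h₁, h₂⟩ := exists_normal N
  have hirr := hS.mono hUS
  obtain ⟨_, hmem, rfl⟩ := exists_mem_of_rewrites (p := fun V => V = U)
    (fun V χ R _ hV hR => (hirr.2 χ (hV ▸ Finset.mem_insert_self _ _) R hR).elim)
    (fun V hV => hV ▸ hirr.1) h₁ ⟨U, hU, rfl⟩
  exact ⟨N', ⟨hN.trans h₁, h₂⟩, _, hmem, hUS⟩

theorem eq_singleton_or_tracks (h : ReflTransGen Rewrite {{ψ}} N) (hS : S ∈ N) :
    S = {ψ} ∨ ∃ R, Decomp ψ R ∧ ∃ T ∈ R, ∀ χ ∈ T, Tracks χ S := by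
  refine forall_mem_of_rewrites (p := fun S => S = {ψ} ∨ ∃ R, Decomp ψ R ∧ ∃ T ∈ R, ∀ χ ∈ T,
    Tracks χ S) (fun S φ R hφ hp hR T hT => Or.inr ?_) h
    (fun S hS => Or.inl (Finset.mem_singleton.1 hS)) S hS
  rcases hp with hp | ⟨R', hR', T', hT', h⟩
  · have : φ = ψ := Finset.mem_singleton.1 (hp ▸ Finset.mem_insert_self φ S)
    subst this
    exact ⟨R, hR, T, hT, fun χ hχ => tracks_of_mem (Finset.mem_union_right _ hχ)⟩
  · exact ⟨R', hR', T', hT', fun χ hχ => (h χ hχ).union hR hT⟩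

/-- An irreducible state contains a formula only if it has the formula as a member or contains all
formulae of one branch of a decomposition of it. -/
theorem mem_or_contains (hS : Irreducible S) (h : Contains (.state S) ψ) :
    ψ ∈ S ∨ ∃ R, Decomp ψ R ∧ ∃ T ∈ R, ∀ χ ∈ T, Contains (.state S) χ := by
  obtain ⟨N, hN, U, hU, hUS⟩ := h
  rcases eq_singleton_or_tracks hN.1 hU with rfl | ⟨R, hR, T, hT, h⟩
  · exact Or.inl (hUS (Finset.mem_singleton_self _))
  · refine Or.inr ⟨R, hR, T, hT, fun χ hχ => Tracks.contains ?_ hS⟩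
    obtain ⟨N', hN', V, hV, hVU⟩ := h χ hχ
    exact ⟨N', hN', V, hV, hVU.trans hUS⟩

/-- The given rule only shows that `ψ` is not a member. The branch found may come from another rule,
since `tt U β` and `ff R β` each match two. -/
theorem exists_contains_of_decomp (hS : Irreducible S) (h : Contains (.state S) ψ)
    (hR : Decomp ψ R) : ∃ R, Decomp ψ R ∧ ∃ T ∈ R, ∀ χ ∈ T, Contains (.state S) χ :=
  (mem_or_contains hS h).resolve_left fun hψ => hS.2 ψ hψ R hR

theorem mem_of_contains (hS : Irreducible S) (h : Contains (.state S) ψ)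
    (hR : ∀ R, ¬ Decomp ψ R) : ψ ∈ S :=
  (mem_or_contains hS h).resolve_right fun ⟨R, hR', _⟩ => hR R hR'

theorem mem_of_contains_next (hS : Irreducible S) (h : Contains (.state S) (next ψ)) :
    next ψ ∈ S :=
  mem_of_contains hS h (by rintro R ⟨⟩)

theorem contains_and (hS : Irreducible S) (h : Contains (.state S) (and φ ψ)) :
    Contains (.state S) φ ∧ Contains (.state S) ψ := by
  obtain ⟨R, hR, T, hT, h⟩ := exists_contains_of_decomp hS h (.d2 _ _)
  cases hR
  rw [Finset.mem_singleton.1 hT] at h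
  exact ⟨h _ (by simp), h _ (by simp)⟩

theorem contains_or (hS : Irreducible S) (h : Contains (.state S) (or φ ψ)) :
    Contains (.state S) φ ∨ Contains (.state S) ψ := by
  obtain ⟨R, hR, T, hT, h⟩ := exists_contains_of_decomp hS h (.d1 _ _)
  cases hR
  simp only [Finset.mem_insert, Finset.mem_singleton] at hT
  rcases hT with rfl | rfl
  · exact Or.inl (h _ (by simp))
  · exact Or.inr (h _ (by simp))

/-- The alternative `φ = tt` accounts for the rule for `◇`, whose postponing branch does not mention
`tt`. -/
theorem contains_untl (hS : Irreducible S) (h : Contains (.state S) (untl φ ψ)) :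
    Contains (.state S) ψ ∨ (φ = tt ∨ Contains (.state S) φ) ∧ next (untl φ ψ) ∈ S := by
  obtain ⟨R, hR, T, hT, h⟩ := exists_contains_of_decomp hS h (.d5 _ _)
  generalize hχ : untl φ ψ = χ at hR
  cases hR <;> simp only [eventually, always, untl.injEq, reduceCtorEq] at hχ <;>
    obtain ⟨rfl, rfl⟩ := hχ <;>
    simp only [Finset.mem_insert, Finset.mem_singleton] at hT <;> rcases hT with rfl | rfl
  · exact Or.inl (h _ (by simp))
  · exact Or.inr ⟨Or.inl rfl, mem_of_contains_next hS (h _ (by simp [eventually]))⟩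
  · exact Or.inl (h _ (by simp))
  · exact Or.inr ⟨Or.inr (h _ (by simp)), mem_of_contains_next hS (h _ (by simp))⟩

theorem contains_release (hS : Irreducible S) (h : Contains (.state S) (release φ ψ)) :
    Contains (.state S) ψ ∧ (Contains (.state S) φ ∨ next (release φ ψ) ∈ S) := by
  obtain ⟨R, hR, T, hT, hc⟩ := exists_contains_of_decomp hS h (.d6 _ _)
  generalize hχ : release φ ψ = χ at hR
  cases hR <;> simp only [eventually, always, release.injEq, reduceCtorEq] at hχ <;>
    obtain ⟨rfl, rfl⟩ := hχ <;> obtain rfl := Finset.mem_singleton.1 hT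
  · exact ⟨hc _ (by simp), Or.inr (mem_of_contains_next hS (hc _ (by simp [always])))⟩
  · exact ⟨hc _ (by simp),
      (contains_or hS (hc (or _ _) (by simp))).imp_right (mem_of_contains_next hS)⟩

theorem IsConjunct.contains {χ : PNF AP} (hψ : IsConjunct ψ χ) (hS : Irreducible S)
    (h : Contains (.state S) χ) : Contains (.state S) ψ := by
  induction hψ with
  | self => exact h
  | left _ ih => exact ih (contains_and hS h).1
  | right _ ih => exact ih (contains_and hS h).2

theorem mem_nexts : ψ ∈ nexts S ↔ next ψ ∈ S := by
  simp only [nexts, Finset.mem_biUnion]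
  constructor
  · rintro ⟨φ, hφ, h⟩
    cases φ <;> simp at h
    exact h ▸ hφ
  · exact fun h => ⟨_, h, by simp⟩

theorem isConjunct_stepFormula (h : next ψ ∈ S) : IsConjunct ψ (stepFormula S) :=
  isConjunct_conjList (by simpa using mem_nexts.2 h)

end Rewriting

section Decomposition

variable {D : PNF AP → Finset (Finset (PNF AP))} {ψ χ : PNF AP}
  {S : Finset (PNF AP)}

theorem IsDecomposition.irreducible (hD : IsDecomposition D) (h : S ∈ D χ) : Irreducible S :=
  normal_iff.1 (hD χ).2 S h

theorem IsDecomposition.contains (hD : IsDecomposition D) (h : S ∈ D χ)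
    (hψ : IsConjunct ψ χ) : Contains (.state S) ψ :=
  IsConjunct.contains hψ (hD.irreducible h) ⟨_, hD χ, S, h, subset_rfl⟩

end Decomposition

/-! ### Satisfiable formulae are not eliminated -/

section SatisfiableNotEliminated

variable {A : Type u} {I : A → Set AP} {w : ℕ → A} {φ ψ χ α : PNF AP}
  {S : Finset (PNF AP)} {R : Finset (Finset (PNF AP))}

theorem not_clash_of_models (h : ∀ φ ∈ S, Models I w φ) : ¬ Clash S := by
  rintro (hf | ⟨p, hp, hn⟩)
  · exact not_models_ff (h _ hf)
  · exact models_neg.1 (h _ hn) (models_pos.1 (h _ hp))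

theorem Decomp.exists_models (h : Decomp φ R) (hφ : Models I w φ) :
    ∃ T ∈ R, ∀ χ ∈ T, Models I w χ := by
  cases h
  case d1 => simpa using hφ
  case d2 => simpa using hφ
  case d3 => rw [eventually, models_untl_iff] at hφ; simpa [eventually] using hφ
  case d4 => rw [always, models_release_iff] at hφ; simpa [always] using hφ
  case d5 => rw [models_untl_iff] at hφ; simpa using hφ
  case d6 => rw [models_release_iff] at hφ; simpa using hφ
  case top => simp

theorem models_union {T : Finset (PNF AP)} (hS : ∀ χ ∈ insert φ S, Models I w χ)
    (hT : ∀ χ ∈ T, Models I w χ) : ∀ χ ∈ S ∪ T, Models I w χ := fun χ hχ =>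
  (Finset.mem_union.1 hχ).elim (fun h => hS χ (Finset.mem_insert_of_mem h)) (hT χ)

/-- The node is true on the word: its formula, or all its formulae, hold. -/
def NodeModels (I : A → Set AP) (w : ℕ → A) : Node AP → Prop
  | .pre χ => Models I w χ
  | .state S => ∀ χ ∈ S, Models I w χ

theorem models_stepFormula (h : ∀ χ ∈ S, Models I w χ) :
    Models I (suffix w 1) (stepFormula S) :=
  models_conjList fun ψ hψ => models_next.1 (h _ (mem_nexts.1 (by simpa using hψ)))

variable {D : PNF AP → Finset (Finset (PNF AP))}

theorem exists_state_models (hD : IsDecomposition D) (hχ : Models I w χ) :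
    ∃ S ∈ D χ, ∀ φ ∈ S, Models I w φ := by
  refine exists_mem_of_rewrites (p := fun S => ∀ φ ∈ S, Models I w φ)
    (fun S φ R _ h hR => ?_) (fun S => not_clash_of_models) (hD χ).1 ⟨{χ}, by simp, by simpa⟩
  obtain ⟨T, hT, hTm⟩ := hR.exists_models (h φ (Finset.mem_insert_self _ _))
  exact ⟨T, hT, models_union h hTm⟩

/-- Some child of a true pre-state is true and postpones an until-formula only if this formula is
not fulfilled immediately. -/
theorem exists_state_models_untl (hD : IsDecomposition D) (hχ : Models I w χ)
    (hu : IsConjunct (untl α ψ) χ) :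
    ∃ S ∈ D χ, (∀ φ ∈ S, Models I w φ) ∧
      (Contains (.state S) ψ ∨ ¬ Models I w ψ ∧ next (untl α ψ) ∈ S) := by
  have key : ∃ S ∈ D χ, (∀ φ ∈ S, Models I w φ) ∧ ((∃ ξ ∈ S, IsConjunct (untl α ψ) ξ) ∨
      Tracks ψ S ∨ ¬ Models I w ψ ∧ next (untl α ψ) ∈ S) := by
    -- Invariant of the chosen branch: the until-formula is still to be decomposed, possibly inside
    -- a conjunction, or `ψ` has been chosen, or `ψ` is false and the until-formula is postponed.
    refine exists_mem_of_rewrites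
      (p := fun S => (∀ φ ∈ S, Models I w φ) ∧ ((∃ ξ ∈ S, IsConjunct (untl α ψ) ξ) ∨
          Tracks ψ S ∨ ¬ Models I w ψ ∧ next (untl α ψ) ∈ S))
      ?_ (fun S h => not_clash_of_models h.1) (hD χ).1
      ⟨{χ}, by simp, by simpa, Or.inl ⟨χ, by simp, hu⟩⟩
    rintro S φ R - ⟨hm, h⟩ hR
    have hφ := hm φ (Finset.mem_insert_self _ _)
    have htrack : ∀ {ξ T}, ξ ∈ T → IsConjunct (untl α ψ) ξ →
        ∃ ξ ∈ S ∪ T, IsConjunct (untl α ψ) ξ := fun hξ h =>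
      ⟨_, Finset.mem_union_right _ hξ, h⟩
    rcases h with ⟨ξ, hξ, h⟩ | h | ⟨hn, h⟩
    · rcases Finset.mem_insert.1 hξ with rfl | hξ
      -- Here `β` is what the postponing branch requires now: `α` in general, `tt` under the rule
      -- for `◇`.
      · have huntl : ∀ β, Models I w (untl α ψ) → (Models I w α → Models I w β) →
            (Models I w ψ ∧ (∀ χ ∈ ({ψ} : Finset (PNF AP)), Models I w χ)) ∨
            (¬ Models I w ψ ∧ Models I w β ∧ Models I w (next (untl α ψ))) := by
          intro β h hβ
          by_cases hψ : Models I w ψ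
          · exact Or.inl ⟨hψ, by simpa⟩
          · have := (models_untl_iff.1 h).resolve_left hψ
            exact Or.inr ⟨hψ, hβ this.1, models_next.2 this.2⟩
        generalize hζ : ξ = ζ at hR
        cases h with
        | self =>
          cases hR <;> simp only [eventually, always, untl.injEq, reduceCtorEq] at hζ <;>
            obtain ⟨rfl, rfl⟩ := hζ
          · rcases huntl tt hφ (fun _ => models_tt) with ⟨-, h⟩ | ⟨hn, -, h⟩
            · exact ⟨{ψ}, by simp, models_union hm h, Or.inr (Or.inl (tracks_of_mem (by simp)))⟩
            · exact ⟨_, by simp [eventually]; exact Or.inr rfl,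
                models_union hm (by simpa using h),
                Or.inr (Or.inr ⟨hn, by simp⟩)⟩
          · rcases huntl α hφ id with ⟨-, h⟩ | ⟨hn, h₁, h₂⟩
            · exact ⟨{ψ}, by simp, models_union hm h, Or.inr (Or.inl (tracks_of_mem (by simp)))⟩
            · exact ⟨{α, next (untl α ψ)}, by simp,
                models_union hm (by simpa [h₁] using h₂), Or.inr (Or.inr ⟨hn, by simp⟩)⟩
        | left h | right h =>
          cases hR <;> simp only [eventually, always, and.injEq, reduceCtorEq] at hζ
          obtain ⟨rfl, rfl⟩ := hζ
          exact ⟨_, Finset.mem_singleton_self _, models_union hm (by simpa using hφ),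
            Or.inl (htrack (by simp) h)⟩
      · obtain ⟨T, hT, hTm⟩ := hR.exists_models hφ
        exact ⟨T, hT, models_union hm hTm, Or.inl ⟨ξ, Finset.mem_union_left _ hξ, h⟩⟩
    · obtain ⟨T, hT, hTm⟩ := hR.exists_models hφ
      exact ⟨T, hT, models_union hm hTm, Or.inr (Or.inl (h.union hR hT))⟩
    · obtain ⟨T, hT, hTm⟩ := hR.exists_models hφ
      refine ⟨T, hT, models_union hm hTm, Or.inr (Or.inr ⟨hn, Finset.mem_union_left _ ?_⟩)⟩
      refine (Finset.mem_insert.1 h).resolve_left ?_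
      rintro rfl
      cases hR
  obtain ⟨S, hS, hm, h⟩ := key
  refine ⟨S, hS, hm, ?_⟩
  have hirr := hD.irreducible hS
  -- In an irreducible state the first alternative is void: `ξ` would be an until-formula or a
  -- conjunction.
  rcases h with ⟨ξ, hξ, h⟩ | h | h
  · cases h with
    | self => exact (hirr.2 _ hξ _ (.d5 _ _)).elim
    | left => exact (hirr.2 _ hξ _ (.d2 _ _)).elim
    | right => exact (hirr.2 _ hξ _ (.d2 _ _)).elim
  · exact Or.inl (h.contains hirr)
  · exact Or.inr h

/-- Induction on the position where `ψ` holds: each postponement makes the until-formula a conjunct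
of the next pre-state and brings that position one closer. At position 0 postponing is impossible.
-/
theorem fulfillable_of_models (hD : IsDecomposition D) (n : ℕ) (w : ℕ → A) (χ : PNF AP)
    (hχ : Models I w χ) (hu : IsConjunct (untl α ψ) χ) (hn : Models I (suffix w n) ψ) :
    Fulfillable D {v | ¬ ∃ w, NodeModels I w v} (.pre χ) ψ := by
  induction n generalizing w χ with
  | zero =>
    obtain ⟨S, hS, hm, h | h⟩ := exists_state_models_untl hD hχ hu
    · exact ⟨_, .single ⟨.decomposition hS, fun hn => hn ⟨w, hm⟩⟩, h⟩
    · exact absurd (by simpa using hn) h.1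
  | succ n ih =>
    obtain ⟨S, hS, hm, h | h⟩ := exists_state_models_untl hD hχ hu
    · exact ⟨_, .single ⟨.decomposition hS, fun hn => hn ⟨w, hm⟩⟩, h⟩
    · have hstep := models_stepFormula hm
      obtain ⟨v, hv, hc⟩ := ih (suffix w 1) _ hstep (isConjunct_stepFormula h.2)
        (by rwa [suffix_suffix, Nat.add_comm])
      exact ⟨v, .head ⟨.decomposition hS, fun hn => hn ⟨w, hm⟩⟩
        (.head ⟨.step S, fun hn => hn ⟨_, hstep⟩⟩ hv), hc⟩

theorem not_mem_eliminated_of_models (hD : IsDecomposition D) (h : Models I w φ) :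
    Node.pre φ ∉ Eliminated D φ := by
  intro hmem
  refine Set.mem_sInter.1 hmem {v | ¬ ∃ w, NodeModels I w v} ?_ ⟨w, h⟩
  rintro v - hE ⟨w, hw⟩
  rcases hE with hE | ⟨⟨χ, rfl⟩, α, ψ, hu, hf⟩
  · cases v with
    | pre χ =>
      obtain ⟨S, hS, hm⟩ := exists_state_models hD hw
      exact hE _ (.decomposition hS) ⟨w, hm⟩
    | state S => exact hE _ (.step S) ⟨_, models_stepFormula hw⟩
  · obtain ⟨n, -, hn⟩ := models_untl.1 (IsConjunct.models hu hw)
    exact hf (fulfillable_of_models hD n w χ hw hu hn)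

end SatisfiableNotEliminated

/-! ### Formulae that are not eliminated are satisfiable -/

section NotEliminatedSatisfiable

variable {D : PNF AP → Finset (Finset (PNF AP))} {φ ψ χ : PNF AP}

theorem E2.mono {E E' : Set (Node AP)} (h : E ⊆ E') {v : Node AP} (hv : E2 D E v) : E2 D E' v :=
  fun w hw => h (hv w hw)

theorem E3.mono {E E' : Set (Node AP)} (h : E ⊆ E') {v : Node AP} (hv : E3 D E v) :
    E3 D E' v := by
  obtain ⟨hpre, α, ψ, hu, hf⟩ := hv
  refine ⟨hpre, α, ψ, hu, fun ⟨w, hw, hc⟩ => hf ⟨w, ?_, hc⟩⟩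
  exact ReflTransGen.mono (fun x y hxy => ⟨hxy.1, fun hy => hxy.2 (h hy)⟩) _ _ hw

/-- E2 and E3 are monotone in the eliminated set, so the intersection of all closed sets is itself
closed. -/
theorem eliminated_closed {v : Node AP} (hv : v ∈ Generated D φ)
    (h : E2 D (Eliminated D φ) v ∨ E3 D (Eliminated D φ) v) : v ∈ Eliminated D φ := by
  refine Set.mem_sInter.2 fun E hE => hE v hv ?_
  have hsub : Eliminated D φ ⊆ E := Set.sInter_subset_of_mem hE
  exact h.imp (E2.mono hsub) (E3.mono hsub)

/-- The states of the tableau that have not been eliminated. -/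
def LiveState (D : PNF AP → Finset (Finset (PNF AP))) (φ : PNF AP) : Type u :=
  {S : Finset (PNF AP) //
    (∃ χ, S ∈ D χ) ∧ Node.state S ∈ Generated D φ ∧ Node.state S ∉ Eliminated D φ}

/-- One step of the tableau from state to state. -/
def LiveStep (S S' : LiveState D φ) : Prop := S'.1 ∈ D (stepFormula S.1)

theorem exists_child (hg : Node.pre χ ∈ Generated D φ) (he : Node.pre χ ∉ Eliminated D φ) :
    ∃ S : LiveState D φ, S.1 ∈ D χ := by
  have h : ¬ E2 D (Eliminated D φ) (.pre χ) := fun h => he (eliminated_closed hg (Or.inl h))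
  simp only [E2, not_forall] at h
  obtain ⟨v, hv, hve⟩ := h
  have hvg : v ∈ Generated D φ := ReflTransGen.tail hg hv
  cases hv with
  | decomposition hS => exact ⟨⟨_, ⟨χ, hS⟩, hvg, hve⟩, hS⟩

theorem LiveState.generated_step (S : LiveState D φ) :
    Node.pre (stepFormula S.1) ∈ Generated D φ :=
  ReflTransGen.tail S.2.2.1 (.step S.1)

theorem LiveState.step_not_mem_eliminated (S : LiveState D φ) :
    Node.pre (stepFormula S.1) ∉ Eliminated D φ := by
  refine fun h => S.2.2.2 (eliminated_closed S.2.2.1 (Or.inl ?_))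
  rintro _ ⟨⟩
  exact h

theorem LiveState.exists_step (S : LiveState D φ) : ∃ S', LiveStep S S' :=
  exists_child S.generated_step S.step_not_mem_eliminated

theorem LiveState.irreducible (hD : IsDecomposition D) (S : LiveState D φ) : Irreducible S.1 :=
  hD.irreducible S.2.1.choose_spec

/-- Paths alternate between pre-states and states, hence the two simultaneous claims. A path that
ends in a pre-state containing `ψ` is prolonged to a surviving child, which contains `ψ` as well. -/
theorem exists_run_of_path (hD : IsDecomposition D) {v v' : Node AP}
    (h : ReflTransGen (fun x y => Child D x y ∧ y ∉ Eliminated D φ) v v')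
    (hg : v ∈ Generated D φ) (he : v ∉ Eliminated D φ) (hc : Contains v' ψ) :
    (∀ χ, v = .pre χ → ∃ S S' : LiveState D φ, S.1 ∈ D χ ∧ ReflTransGen LiveStep S S' ∧
      Contains (.state S'.1) ψ) ∧
    (∀ S : LiveState D φ, v = .state S.1 → ∃ S' : LiveState D φ, ReflTransGen LiveStep S S' ∧
      Contains (.state S'.1) ψ) := by
  induction h using ReflTransGen.head_induction_on with
  | refl =>
    refine ⟨?_, ?_⟩
    · rintro χ rfl
      obtain ⟨S, hS⟩ := exists_child hg he
      exact ⟨S, S, hS, .refl, hD.contains hS hc⟩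
    · rintro S rfl
      exact ⟨S, .refl, hc⟩
  | head h _ ih =>
    have hg' := ReflTransGen.tail hg h.1
    obtain ⟨ih₁, ih₂⟩ := ih hg' h.2
    obtain ⟨h, he'⟩ := h
    cases h with
    | decomposition hS =>
      refine ⟨?_, by simp⟩
      rintro _ ⟨⟩
      obtain ⟨S', hr, hc'⟩ := ih₂ ⟨_, ⟨_, hS⟩, hg', he'⟩ rfl
      exact ⟨_, S', hS, hr, hc'⟩
    | step U =>
      refine ⟨by simp, ?_⟩
      rintro S ⟨⟩
      obtain ⟨S₁, S', hS₁, hr, hc'⟩ := ih₁ _ rfl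
      exact ⟨S', .head hS₁ hr, hc'⟩

theorem LiveStep.contains_untl (hD : IsDecomposition D) {S S' : LiveState D φ} {α : PNF AP}
    (h : LiveStep S S') (hu : Contains (.state S.1) (untl α ψ))
    (hn : ¬ Contains (.state S.1) ψ) : Contains (.state S'.1) (untl α ψ) :=
  hD.contains h (isConjunct_stepFormula
    ((Tableau.contains_untl (S.irreducible hD) hu).resolve_left hn).2)

/-- E3 speaks only of pre-states. A state that does not yet contain `ψ` postpones the until-formula,
so E3 applies to the pre-state that follows it. -/
theorem LiveState.exists_fulfilling_run (hD : IsDecomposition D) (S : LiveState D φ) {α : PNF AP}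
    (hu : Contains (.state S.1) (untl α ψ)) :
    ∃ S' : LiveState D φ, ReflTransGen LiveStep S S' ∧ Contains (.state S'.1) ψ := by
  rcases Tableau.contains_untl (S.irreducible hD) hu with h | ⟨-, h⟩
  · exact ⟨S, .refl, h⟩
  have hf : Fulfillable D (Eliminated D φ) (.pre (stepFormula S.1)) ψ := by
    by_contra hf
    exact S.step_not_mem_eliminated (eliminated_closed S.generated_step
      (Or.inr ⟨⟨_, rfl⟩, α, ψ, isConjunct_stepFormula h, hf⟩))
  obtain ⟨v, hv, hc⟩ := hf
  obtain ⟨S₁, S', hS₁, hr, hc'⟩ := (exists_run_of_path hD hv S.generated_step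
    S.step_not_mem_eliminated hc).1 _ rfl
  exact ⟨S', .head hS₁ hr, hc'⟩

theorem exists_fair_state_run [Finite AP] (hD : IsDecomposition D) (S : LiveState D φ) :
    ∃ f : ℕ → LiveState D φ, f 0 = S ∧ (∀ i, LiveStep (f i) (f (i + 1))) ∧
      ∀ α ψ i, Contains (.state (f i).1) (untl α ψ) →
        ∃ j ≥ i, Contains (.state (f j).1) ψ := by
  obtain ⟨f, h0, hf, h⟩ := exists_fair_run (V := LiveState D φ) (K := PNF AP × PNF AP)
    (R := LiveStep) (P := fun k S => Contains (.state S.1) (untl k.1 k.2))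
    (Q := fun k S => Contains (.state S.1) k.2) LiveState.exists_step
    (fun k S S' hu hn h => h.contains_untl hD hu hn)
    (fun k S hu => S.exists_fulfilling_run hD hu) S
  exact ⟨f, h0, hf, fun α ψ i hu => h (α, ψ) i hu⟩

/-- On the word that makes exactly the positive literals of the states of a fair run true, the
formulae contained in these states hold. -/
theorem models_of_fair_run (hD : IsDecomposition D) {f : ℕ → LiveState D φ}
    (hf : ∀ i, LiveStep (f i) (f (i + 1)))
    (hfair : ∀ α ψ i, Contains (.state (f i).1) (untl α ψ) →
      ∃ j ≥ i, Contains (.state (f j).1) ψ) (ψ : PNF AP) (i : ℕ)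
    (h : Contains (.state (f i).1) ψ) :
    Models id (suffix (fun i => {p : AP | pos p ∈ (f i).1}) i) ψ := by
  have hirr := fun i => (f i).irreducible hD
  have hnext : ∀ {χ i}, next χ ∈ (f i).1 → Contains (.state (f (i + 1)).1) χ :=
    fun hχ => hD.contains (hf _) (isConjunct_stepFormula hχ)
  induction ψ generalizing i with
  | pos p => simpa [suffix] using mem_of_contains (hirr i) h (by rintro R ⟨⟩)
  | neg p =>
    have hn := mem_of_contains (hirr i) h (by rintro R ⟨⟩)
    have : pos p ∉ (f i).1 := fun hp => (hirr i).1 (Or.inr ⟨p, hp, hn⟩)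
    simpa [suffix] using this
  | tt => exact models_tt
  | ff => exact ((hirr i).1 (Or.inl (mem_of_contains (hirr i) h (by rintro R ⟨⟩)))).elim
  | and α β ihα ihβ =>
    exact models_and.2 ((contains_and (hirr i) h).imp (ihα i) (ihβ i))
  | or α β ihα ihβ =>
    exact models_or.2 ((contains_or (hirr i) h).imp (ihα i) (ihβ i))
  | next α ih =>
    rw [models_next, suffix_suffix]
    exact ih _ (hnext (mem_of_contains_next (hirr i) h))
  | untl α β ihα ihβ =>
    obtain ⟨j, hj, hβ⟩ := hfair α β i h
    obtain ⟨d, rfl⟩ := Nat.exists_eq_add_of_le hj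
    clear hj
    -- Induction on the distance to a fulfilling state; until then each state either fulfils `β`
    -- itself or passes the until-formula on.
    induction d generalizing i with
    | zero => exact models_untl_iff.2 (Or.inl (ihβ i hβ))
    | succ d ih =>
      rw [models_untl_iff, suffix_suffix]
      rcases contains_untl (hirr i) h with h | ⟨hα, hx⟩
      · exact Or.inl (ihβ i h)
      · refine Or.inr ⟨?_, ih _ (hnext hx) (by rwa [Nat.add_right_comm])⟩
        rcases hα with rfl | hα
        · exact models_tt
        · exact ihα i hα
  | release α β ihα ihβ =>
    rw [models_release]
    intro n hn
    simp only [suffix_suffix] at hn ⊢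
    -- Fairness plays no role here: the release is passed on until `α` is contained, and `hn`
    -- excludes that before position `n`.
    induction n generalizing i with
    | zero => exact ihβ i (contains_release (hirr i) h).1
    | succ n ih =>
      rcases (contains_release (hirr i) h).2 with h | h
      · exact absurd (ihα i h) (hn 0 (by omega))
      · rw [← Nat.add_assoc, Nat.add_right_comm]
        refine ih _ (hnext h) fun j hj => ?_
        rw [Nat.add_assoc, Nat.add_comm 1]
        exact hn _ (by omega)

theorem satisfiable_of_not_mem_eliminated [Finite AP] (hD : IsDecomposition D)
    (h : Node.pre φ ∉ Eliminated D φ) : φ.Satisfiable := by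
  obtain ⟨S, hS⟩ := exists_child .refl h
  obtain ⟨f, rfl, hf, hfair⟩ := exists_fair_state_run hD S
  have := models_of_fair_run hD hf hfair φ 0 (hD.contains hS .self)
  exact ⟨Set AP, inferInstance, id, _, this⟩

end NotEliminatedSatisfiable

end Tableau

theorem mainTheorem4 {AP : Type u} [Finite AP] [LinearOrder (PNF AP)] :
    (∃ D : PNF AP → Finset (Finset (PNF AP)), Tableau.IsDecomposition D) ∧
    ∀ D : PNF AP → Finset (Finset (PNF AP)), Tableau.IsDecomposition D →
      ∀ φ : PNF AP,
        φ.Satisfiable ↔ Tableau.Node.pre φ ∉ Tableau.Eliminated D φ := by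
  refine ⟨Tableau.exists_isDecomposition, fun D hD φ => ⟨?_, ?_⟩⟩
  · rintro ⟨A, -, I, w, h⟩
    exact Tableau.not_mem_eliminated_of_models hD h
  · exact Tableau.satisfiable_of_not_mem_eliminated hD
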